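/- Let $k\ge 0$ be an integer and let $\mathcal P_k$ be the set of partitions of the set $\{1,\dots,k\}\cup\{1',\dots,k'\}$ of $2k$ elements. For a partition $p$ let $\mathsf{nc}(p)$ be its number of blocks, and let $\mathrm{id}_k=\{\{i,i'\}: 1\le i\le k\}$. Let $d(p,q)$ be half of the graph distance between $p$ and $q$ in the graph on $\mathcal P_k$ in which two partitions are adjacent if and only if one is obtained from the other by gluing two distinct blocks. The geodesic order on $\mathcal P_k$ is given by $p'\le p$ if and only if $d(\mathrm{id}_k,p')+d(p',p)=d(\mathrm{id}_k,p)$. For $p,p'\in\mathcal P_k$ represent partitions by diagrams with top row $1,\dots,k$ and bottom row $1',\dots,k'$, put a diagram of $p'$ above a diagram of $p$ and identify the bottom row of $p'$ with the top row of $p$. Let $p\circ p'\in\mathcal P_k$ be the partition that the connected components of this three-row diagram induce on its top and bottom rows, and let $\kappa(p,p')$ be the number of connected components entirely contained in the middle row. For $p,p'\in\mathcal P_k$ the Kreweras complement $\mathsf K_p(p')$ is the set of $p''\in\mathcal P_k$ such that $p=p'\circ p''$ and $$d(\mathrm{id}_k,p)=d(\mathrm{id}_k,p')+d(\mathrm{id}_k,p'')-\frac{k+\mathsf{nc}(p)-\mathsf{nc}(p')-\mathsf{nc}(p'')}{2}-\kappa(p',p'').$$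 One says that $p'$ is an admissible prefix of $p$, written $p'\prec p$, if $\mathsf K_p(p')\neq\emptyset$. **Theorem.** The relation $\prec$ is a partial order on $\mathcal P_k$ (it is reflexive, antisymmetric and transitive). For all $p,p'\in\mathcal P_k$, $p'\prec p$ implies $p'\le p$. If $k\ge 2$, then $\prec$ is different from $\le$: there are $p,p'\in\mathcal P_k$ such that $p'\le p$ but not $p'\prec p$. -/

import Mathlib

noncomputable section

namespace PartitionOrders

/-! ### Partitions of a set, the Cayley graph, the geodesic distance -/

/-- The number `nc p` of blocks of a partition `p` (a partition is given by its equivalence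
relation "to lie in the same block"; `p.classes` is its set of blocks). -/
def nc {X : Type*} (p : Setoid X) : ℕ := p.classes.ncard

/-- `q` is obtained from `p` by gluing two distinct blocks of `p`: the block of `x` and the
block of `y`. -/
def Glue {X : Type*} (p q : Setoid X) : Prop :=
  ∃ x y : X, ¬ p x y ∧ ∀ u v : X, q u v ↔ p u v ∨ (p u x ∧ p v y) ∨ (p u y ∧ p v x)

theorem Glue.ne {X : Type*} {p q : Setoid X} (h : Glue p q) : p ≠ q := by
  rintro rfl
  obtain ⟨x, y, hxy, h⟩ := h
  exact hxy ((h x y).2 (Or.inr (Or.inl ⟨p.refl x, p.refl y⟩)))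

/-- The Cayley graph on partitions of `X`: `p` and `q` are joined by an edge if and only if one
can go from one to the other by gluing two blocks. -/
def cayleyGraph (X : Type*) : SimpleGraph (Setoid X) where
  Adj p q := Glue p q ∨ Glue q p
  symm := ⟨fun _ _ h => h.symm⟩
  loopless := ⟨fun _ h => h.elim (fun g => g.ne rfl) (fun g => g.ne rfl)⟩

/-- The geodesic distance: half of the minimal length of a path in the Cayley graph. -/
def geodDist {X : Type*} (p q : Setoid X) : ℚ := ((cayleyGraph X).dist p q : ℚ) / 2

/-- The segment `[p₁, p₂]` for the geodesic distance. -/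
def segment {X : Type*} (p₁ p₂ : Setoid X) : Set (Setoid X) :=
  {p | geodDist p₁ p + geodDist p p₂ = geodDist p₁ p₂}

/-! ### Partitions of `{1, …, k, 1', …, k'}` -/

/-- The set `𝒫_k`; `Sum.inl i` is the vertex `i` of the top row, `Sum.inr i` the vertex `i'` of
the bottom row. -/
abbrev Part (k : ℕ) : Type := Setoid (Fin k ⊕ Fin k)

/-- The partition `id_k = {{i, i'} : 1 ≤ i ≤ k}`. -/
def idPart (k : ℕ) : Part k := Setoid.ker (Sum.elim id id)

/-- The geodesic order with base partition `id_k`: `p' ≤ p` when `p'` lies in `[id_k, p]`. -/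
def GeodLE {k : ℕ} (p' p : Part k) : Prop := p' ∈ segment (idPart k) p

/-- The vertices of a diagram with a top, a middle and a bottom row of `k` vertices each. -/
abbrev ThreeRows (k : ℕ) : Type := Fin k ⊕ (Fin k ⊕ Fin k)

/-- Vertex `i` of the middle row. -/
def middle {k : ℕ} (i : Fin k) : ThreeRows k := Sum.inr (Sum.inl i)

/-- The two rows of a diagram placed on the top and middle rows. -/
def topMiddle {k : ℕ} : Fin k ⊕ Fin k → ThreeRows k := Sum.elim Sum.inl middle

/-- The two rows of a diagram placed on the middle and bottom rows. -/
def middleBottom {k : ℕ} : Fin k ⊕ Fin k → ThreeRows k :=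
  Sum.elim middle (fun i => Sum.inr (Sum.inr i))

/-- The two rows of a diagram placed on the top and bottom rows. -/
def topBottom {k : ℕ} : Fin k ⊕ Fin k → ThreeRows k :=
  Sum.elim Sum.inl (fun i => Sum.inr (Sum.inr i))

/-- The diagram of `p'` put above the diagram of `p`, the lower vertices of `p'` being identified
with the upper vertices of `p`; the classes are the connected components. -/
def stack {k : ℕ} (p p' : Part k) : Setoid (ThreeRows k) :=
  Relation.EqvGen.setoid fun x y =>
    (∃ u v, p' u v ∧ topMiddle u = x ∧ topMiddle v = y) ∨
    (∃ u v, p u v ∧ middleBottom u = x ∧ middleBottom v = y)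

/-- The product `p ∘ p'`: the trace of the stacked diagram on the top and bottom rows. -/
def comp {k : ℕ} (p p' : Part k) : Part k := Setoid.comap topBottom (stack p p')

/-- `κ(p, p')`: the number of connected components of the stacked diagram which are entirely
included in the middle row. -/
def kappa {k : ℕ} (p p' : Part k) : ℕ :=
  {c | c ∈ (stack p p').classes ∧ c ⊆ Set.range middle}.ncard

/-- The Kreweras complement `K_p(p')` of `p'` in `p` (a set of partitions). -/
def krewerasCompl {k : ℕ} (p p' : Part k) : Set (Part k) :=
  {p'' | p = comp p' p'' ∧
    geodDist (idPart k) p = geodDist (idPart k) p' + geodDist (idPart k) p''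
      - ((k : ℚ) + (nc p : ℚ) - (nc p' : ℚ) - (nc p'' : ℚ)) / 2 - (kappa p' p'' : ℚ)}

/-- `p' ≺ p`: `p'` is an admissible prefix of `p`. -/
def Prec {k : ℕ} (p' p : Part k) : Prop := (krewerasCompl p p').Nonempty

end PartitionOrders

end

/-! The argument linearizes partitions. Replace a partition by the space of rational functions
constant on its blocks: its dimension is the number of blocks, and joins become intersections. A
shortest path goes through the join, so `geodDist_eq` expresses distances by block counts.

Reading such a function as a pair (top row, bottom row) gives a linear relation. Products become
composites (`rel_comp`), and κ is the dimension of the middle vectors joining 0 to 0 (`kappa_eq`).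
Let the defect be the dimension of the differences top minus bottom. All normalizing terms then
cancel, and `p' ≺ p` says that `p = p' ∘ p''` with defect p + κ = defect p' + defect p''
(`prec_iff`).

In general ≤ holds here, by rank-nullity for adding the increments of a chain t, m, b. With the
cocycle identity for κ this gives transitivity. In the equality case every pair of increments
occurs, which forces the dimension identity that expresses the geodesic order
(`finrank_relComp_inf_of_le`). Antisymmetry is inherited from the geodesic order. -/

namespace PartitionOrders

/-! ### Functions constant on the blocks of a partition -/

/-- The space of rational functions that are constant on the blocks of `p`. -/
def blockFun {X : Type*} (p : Setoid X) : Submodule ℚ (X → ℚ) where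
  carrier := {f | ∀ x y, p x y → f x = f y}
  add_mem' {f g} hf hg x y h := by simp [hf x y h, hg x y h]
  zero_mem' x y h := rfl
  smul_mem' c f hf x y h := by simp [hf x y h]

theorem mem_blockFun {X : Type*} {p : Setoid X} {f : X → ℚ} :
    f ∈ blockFun p ↔ ∀ x y, p x y → f x = f y := Iff.rfl

theorem mem_blockFun_iff_le_ker {X : Type*} {p : Setoid X} {f : X → ℚ} :
    f ∈ blockFun p ↔ p ≤ Setoid.ker f :=
  ⟨fun h _ _ hxy => h _ _ hxy, fun h _ _ hxy => h hxy⟩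

theorem blockFun_le_blockFun_iff {X : Type*} {p q : Setoid X} :
    blockFun q ≤ blockFun p ↔ p ≤ q := by
  classical
  refine ⟨fun h x y hxy => ?_, fun h f hf x y hxy => hf x y (h hxy)⟩
  have hf : (fun z => if q x z then (1 : ℚ) else 0) ∈ blockFun q := by
    intro u v huv
    have : q x u ↔ q x v := ⟨fun h => q.trans h huv, fun h => q.trans h (q.symm huv)⟩
    simp only [this]
  have := h hf x y hxy
  by_contra hn
  simp [show ¬ q x y from hn] at this

theorem blockFun_injective {X : Type*} : Function.Injective (blockFun (X := X)) := fun _ _ h =>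
  le_antisymm (blockFun_le_blockFun_iff.1 h.ge) (blockFun_le_blockFun_iff.1 h.le)

theorem blockFun_sup {X : Type*} (p q : Setoid X) :
    blockFun (p ⊔ q) = blockFun p ⊓ blockFun q := by
  ext f
  simp only [Submodule.mem_inf, mem_blockFun_iff_le_ker, sup_le_iff]

/-- Functions constant on the blocks of `p` are functions on the set of blocks. -/
def blockFunEquiv {X : Type*} (p : Setoid X) : (Quotient p → ℚ) ≃ₗ[ℚ] blockFun p where
  toFun g := ⟨fun x => g (Quotient.mk p x), fun _ _ h => congrArg g (Quotient.sound h)⟩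
  invFun f := Quotient.lift f.1 f.2
  map_add' _ _ := rfl
  map_smul' _ _ := rfl
  left_inv g := by
    ext x
    induction x using Quotient.inductionOn
    rfl
  right_inv _ := rfl

theorem finrank_blockFun {X : Type*} [Finite X] (p : Setoid X) :
    Module.finrank ℚ (blockFun p) = nc p := by
  classical
  have : Fintype (Quotient p) := Fintype.ofFinite _
  rw [← (blockFunEquiv p).finrank_eq, Module.finrank_fintype_fun_eq_card, nc,
    ← Nat.card_coe_set_eq, ← Nat.card_eq_fintype_card]
  exact Nat.card_congr (Setoid.quotientEquivClasses p)

theorem nc_le_nc {X : Type*} [Finite X] {p q : Setoid X} (h : p ≤ q) : nc q ≤ nc p := by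
  rw [← finrank_blockFun, ← finrank_blockFun]
  exact Submodule.finrank_mono (blockFun_le_blockFun_iff.2 h)

theorem eq_of_le_of_nc_le {X : Type*} [Finite X] {p q : Setoid X} (h : p ≤ q)
    (hn : nc p ≤ nc q) : p = q := by
  rw [← finrank_blockFun, ← finrank_blockFun] at hn
  exact blockFun_injective
    (Submodule.eq_of_le_of_finrank_le (blockFun_le_blockFun_iff.2 h) hn).symm

/-! ### Gluing two blocks -/

theorem Glue.le {X : Type*} {p q : Setoid X} (h : Glue p q) : p ≤ q := by
  obtain ⟨x, y, -, h⟩ := h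
  exact fun u v huv => (h u v).2 (Or.inl huv)

/-- Gluing the blocks of x and y imposes the single linear equation f x = f y, which lowers a
dimension by at most one. -/
theorem Glue.nc_sup_le {X : Type*} [Finite X] {p q : Setoid X} (h : Glue p q) (r : Setoid X) :
    nc (r ⊔ p) ≤ nc (r ⊔ q) + 1 := by
  obtain ⟨x, y, hxy, h⟩ := h
  let e : (X → ℚ) →ₗ[ℚ] ℚ := LinearMap.proj (R := ℚ) (φ := fun _ => ℚ) x - LinearMap.proj y
  have hle : blockFun (r ⊔ p) ⊓ LinearMap.ker e ≤ blockFun (r ⊔ q) := by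
    rw [blockFun_sup, blockFun_sup]
    rintro f ⟨⟨hr, hp⟩, he⟩
    have he : f x = f y := sub_eq_zero.1 he
    refine ⟨hr, fun u v huv => ?_⟩
    rcases (h u v).1 huv with h | ⟨h1, h2⟩ | ⟨h1, h2⟩
    · exact hp u v h
    · rw [hp _ _ h1, hp _ _ h2, he]
    · rw [hp _ _ h1, hp _ _ h2, he]
  have h1 := Submodule.finrank_add_le_finrank_add_finrank (blockFun (r ⊔ p)) (LinearMap.ker e)
  have h2 := Submodule.finrank_sup_add_finrank_inf_eq (blockFun (r ⊔ p)) (LinearMap.ker e)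
  have h3 := Submodule.finrank_le (blockFun (r ⊔ p) ⊔ LinearMap.ker e)
  have h4 := LinearMap.finrank_range_add_finrank_ker e
  have h5 := Submodule.finrank_le (LinearMap.range e)
  have h6 := Submodule.finrank_mono hle
  rw [Module.finrank_self] at h5
  rw [← finrank_blockFun, ← finrank_blockFun]
  omega

theorem Glue.nc_eq {X : Type*} [Finite X] {p q : Setoid X} (h : Glue p q) :
    nc p = nc q + 1 := by
  have h1 := h.nc_sup_le ⊥
  rw [bot_sup_eq, bot_sup_eq] at h1
  have h2 : ¬ nc p ≤ nc q := fun hn => h.ne (eq_of_le_of_nc_le h.le hn)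
  omega

theorem exists_glue {X : Type*} (p : Setoid X) {x y : X} (hxy : ¬ p x y) :
    ∃ q, Glue p q ∧ ∀ s, p ≤ s → s x y → q ≤ s := by
  refine ⟨⟨fun u v => p u v ∨ (p u x ∧ p v y) ∨ (p u y ∧ p v x), ?_, ?_, ?_⟩,
    ⟨x, y, hxy, fun _ _ => Iff.rfl⟩, ?_⟩
  · exact fun u => Or.inl (p.refl u)
  · rintro u v (h | h | h)
    · exact Or.inl (p.symm h)
    · exact Or.inr (Or.inr h.symm)
    · exact Or.inr (Or.inl h.symm)
  · rintro u v w (h | ⟨h1, h2⟩ | ⟨h1, h2⟩) (h' | ⟨h3, h4⟩ | ⟨h3, h4⟩)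
    · exact Or.inl (p.trans h h')
    · exact Or.inr (Or.inl ⟨p.trans h h3, h4⟩)
    · exact Or.inr (Or.inr ⟨p.trans h h3, h4⟩)
    · exact Or.inr (Or.inl ⟨h1, p.trans (p.symm h') h2⟩)
    · exact absurd (p.trans (p.symm h3) h2) hxy
    · exact Or.inl (p.trans h1 (p.symm h4))
    · exact Or.inr (Or.inr ⟨h1, p.trans (p.symm h') h2⟩)
    · exact Or.inl (p.trans h1 (p.symm h4))
    · exact absurd (p.trans (p.symm h2) h3) hxy
  · rintro s hs hsxy u v (h | ⟨h1, h2⟩ | ⟨h1, h2⟩)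
    · exact hs h
    · exact s.trans (hs h1) (s.trans hsxy (s.symm (hs h2)))
    · exact s.trans (hs h1) (s.trans (s.symm hsxy) (s.symm (hs h2)))

/-! ### The geodesic distance in terms of numbers of blocks -/

theorem exists_walk_of_le {X : Type*} [Finite X] (n : ℕ) {p s : Setoid X} (h : p ≤ s)
    (hn : nc p = nc s + n) : ∃ w : (cayleyGraph X).Walk p s, w.length = n := by
  induction n generalizing p with
  | zero =>
    obtain rfl := eq_of_le_of_nc_le h hn.le
    exact ⟨.nil, rfl⟩
  | succ n ih =>
    have hlt : ¬ s ≤ p := fun h' => by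
      have := nc_le_nc h'
      omega
    obtain ⟨x, y, hs, hp⟩ : ∃ x y, s x y ∧ ¬ p x y := by
      by_contra! hc
      exact hlt fun x y hxy => hc x y hxy
    obtain ⟨q, hq, hqs⟩ := exists_glue p hp
    obtain ⟨w, hw⟩ := ih (hqs s h hs) (by have := hq.nc_eq; omega)
    have hadj : (cayleyGraph X).Adj p q := Or.inl hq
    exact ⟨.cons hadj w, by rw [SimpleGraph.Walk.length_cons, hw]⟩

/-- Along a gluing, `nc p` drops by one and `nc (q ⊔ p)` by zero or one, so nc p + nc q - 2 nc (q ⊔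
p) changes by ±1 along each edge. -/
theorem nc_add_nc_le_length {X : Type*} [Finite X] {p q : Setoid X}
    (w : (cayleyGraph X).Walk p q) : nc p + nc q ≤ 2 * nc (q ⊔ p) + w.length := by
  induction w with
  | nil => simp [two_mul]
  | @cons p p' q h w ih =>
    rw [SimpleGraph.Walk.length_cons]
    rcases h with h | h
    · have h1 := h.nc_eq
      have h2 := nc_le_nc (sup_le_sup_left h.le q)
      omega
    · have h1 := h.nc_eq
      have h2 := h.nc_sup_le q
      omega

/-- Going up to the join and back down attains the lower bound for walks. -/
theorem geodDist_eq {X : Type*} [Finite X] (p q : Setoid X) :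
    geodDist p q = ((nc p : ℚ) + nc q) / 2 - nc (q ⊔ p) := by
  have hp := nc_le_nc (le_sup_right : p ≤ q ⊔ p)
  have hq := nc_le_nc (le_sup_left : q ≤ q ⊔ p)
  obtain ⟨w, hw⟩ := exists_walk_of_le (nc p - nc (q ⊔ p)) (le_sup_right : p ≤ q ⊔ p) (by omega)
  obtain ⟨w', hw'⟩ := exists_walk_of_le (nc q - nc (q ⊔ p)) (le_sup_left : q ≤ q ⊔ p) (by omega)
  have h1 := SimpleGraph.dist_le (w.append w'.reverse)
  rw [SimpleGraph.Walk.length_append, SimpleGraph.Walk.length_reverse] at h1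
  obtain ⟨u, hu⟩ :=
    SimpleGraph.Reachable.exists_walk_length_eq_dist (w.append w'.reverse).reachable
  have h2 := nc_add_nc_le_length u
  have h3 : (cayleyGraph X).dist p q + 2 * nc (q ⊔ p) = nc p + nc q := by omega
  have h4 : ((cayleyGraph X).dist p q : ℚ) + 2 * nc (q ⊔ p) = nc p + nc q := by
    exact_mod_cast h3
  rw [geodDist]
  linarith

/-! ### Restricting a partition along a map -/

theorem map_funLeft_blockFun {X Y : Type*} (j : X → Y) (S : Setoid Y) :
    (blockFun S).map (LinearMap.funLeft ℚ ℚ j) = blockFun (Setoid.comap j S) := by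
  classical
  ext f
  constructor
  · rintro ⟨g, hg, rfl⟩ x y hxy
    exact hg _ _ hxy
  · intro hf
    -- The extension is 0 on the blocks that miss the range of `j`; elsewhere the block prescribes
    -- the value.
    refine ⟨fun y => if h : ∃ x, S (j x) y then f h.choose else 0, ?_, ?_⟩
    · intro u v huv
      by_cases hu : ∃ x, S (j x) u
      · have hv : ∃ x, S (j x) v := hu.imp fun x hx => S.trans hx huv
        simp only [hu, hv, dif_pos]
        exact hf _ _ (S.trans hu.choose_spec (S.trans huv (S.symm hv.choose_spec)))
      · have hv : ¬ ∃ x, S (j x) v := fun hv => hu (hv.imp fun x hx => S.trans hx (S.symm huv))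
        simp only [hu, hv, dif_neg, not_false_eq_true]
    · ext x
      have hx : ∃ x', S (j x') (j x) := ⟨x, S.refl _⟩
      simp only [LinearMap.funLeft_apply, hx, dif_pos]
      exact hf _ _ hx.choose_spec

/-- A block meeting the range of `j` is determined by its preimage, which is a block of the
restriction; the other blocks disappear. -/
theorem nc_eq_nc_comap_add {X Y : Type*} [Finite Y] (j : X → Y) (S : Setoid Y) :
    nc S = nc (Setoid.comap j S) + {c | c ∈ S.classes ∧ c ⊆ (Set.range j)ᶜ}.ncard := by
  have himg : (Setoid.comap j S).classes =
      (fun c => j ⁻¹' c) '' {c | c ∈ S.classes ∧ ¬ c ⊆ (Set.range j)ᶜ} := by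
    ext d
    constructor
    · rintro ⟨x, rfl⟩
      exact ⟨{y | S y (j x)}, ⟨⟨j x, rfl⟩, fun h => h (S.refl (j x)) ⟨x, rfl⟩⟩, rfl⟩
    · rintro ⟨c, ⟨⟨y, rfl⟩, hc⟩, rfl⟩
      obtain ⟨z, hz, hzr⟩ := Set.not_subset.1 hc
      obtain ⟨x, rfl⟩ := Set.notMem_compl_iff.1 hzr
      refine ⟨x, ?_⟩
      ext x'
      exact ⟨fun h => S.trans h (S.symm hz), fun h => S.trans h hz⟩
  have hinj : Set.InjOn (fun c : Set Y => j ⁻¹' c)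
      {c | c ∈ S.classes ∧ ¬ c ⊆ (Set.range j)ᶜ} := by
    rintro c ⟨hc, hcr⟩ c' ⟨hc', -⟩ h
    obtain ⟨z, hz, hzr⟩ := Set.not_subset.1 hcr
    obtain ⟨x, rfl⟩ := Set.notMem_compl_iff.1 hzr
    have hz' : x ∈ j ⁻¹' c' := h.subset hz
    exact Setoid.eq_of_mem_classes hc hz hc' hz'
  rw [nc, nc, himg, hinj.ncard_image, ← Set.ncard_union_eq _ (Set.toFinite _)
    (Set.toFinite _)]
  · congr 1
    ext c
    simp only [Set.mem_union, Set.mem_ofPred_eq]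
    tauto
  · exact Set.disjoint_left.2 fun c h h' => h.2 h'.2

/-! ### Linear relations -/

theorem finrank_map_add_finrank_inf_ker {E F : Type*} [AddCommGroup E] [Module ℚ E]
    [FiniteDimensional ℚ E] [AddCommGroup F] [Module ℚ F] (f : E →ₗ[ℚ] F) (S : Submodule ℚ E) :
    Module.finrank ℚ (S.map f) + Module.finrank ℚ ↥(S ⊓ LinearMap.ker f)
      = Module.finrank ℚ S := by
  have h := LinearMap.finrank_range_add_finrank_ker (f.domRestrict S)
  rw [LinearMap.range_domRestrict, LinearMap.ker_domRestrict,
    ← Submodule.finrank_map_subtype_eq, Submodule.map_comap_subtype] at h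
  exact h

theorem finrank_map_of_injective {E F : Type*} [AddCommGroup E] [Module ℚ E]
    [AddCommGroup F] [Module ℚ F] {f : E →ₗ[ℚ] F} (hf : Function.Injective f)
    {S : Submodule ℚ E} : Module.finrank ℚ (S.map f) = Module.finrank ℚ S :=
  (Submodule.equivMapOfInjective f hf S).finrank_eq.symm

section LinearRelation

variable {E : Type*} [AddCommGroup E] [Module ℚ E]

/-- The difference map `(x, y) ↦ x - y`. -/
def diff (E : Type*) [AddCommGroup E] [Module ℚ E] : E × E →ₗ[ℚ] E :=
  LinearMap.fst ℚ E E - LinearMap.snd ℚ E E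

@[simp] theorem diff_apply (z : E × E) : diff E z = z.1 - z.2 := rfl

theorem mem_ker_diff {z : E × E} : z ∈ LinearMap.ker (diff E) ↔ z.1 = z.2 := by
  rw [LinearMap.mem_ker, diff_apply, sub_eq_zero]

/-- The composition of two linear relations, `A` being followed first. -/
def relComp (B A : Submodule ℚ (E × E)) : Submodule ℚ (E × E) where
  carrier := {z | ∃ m, (z.1, m) ∈ A ∧ (m, z.2) ∈ B}
  add_mem' := by
    rintro z w ⟨m, h1, h2⟩ ⟨n, h3, h4⟩
    exact ⟨m + n, A.add_mem h1 h3, B.add_mem h2 h4⟩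
  zero_mem' := ⟨0, A.zero_mem, B.zero_mem⟩
  smul_mem' := by
    rintro c z ⟨m, h1, h2⟩
    exact ⟨c • m, A.smul_mem c h1, B.smul_mem c h2⟩

theorem mem_relComp {B A : Submodule ℚ (E × E)} {z : E × E} :
    z ∈ relComp B A ↔ ∃ m, (z.1, m) ∈ A ∧ (m, z.2) ∈ B := Iff.rfl

theorem relComp_assoc (C B A : Submodule ℚ (E × E)) :
    relComp (relComp C B) A = relComp C (relComp B A) := by
  ext z
  constructor
  · rintro ⟨m, h1, n, h2, h3⟩
    exact ⟨n, ⟨m, h1, h2⟩, h3⟩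
  · rintro ⟨n, ⟨m, h1, h2⟩, h3⟩
    exact ⟨m, h1, n, h2, h3⟩

/-- The space of middle vectors that connect `0` to `0` through `A` and then `B`. -/
def relMid (B A : Submodule ℚ (E × E)) : Submodule ℚ E where
  carrier := {m | (0, m) ∈ A ∧ (m, 0) ∈ B}
  add_mem' := by
    rintro m n ⟨h1, h2⟩ ⟨h3, h4⟩
    exact ⟨by simpa using A.add_mem h1 h3, by simpa using B.add_mem h2 h4⟩
  zero_mem' := ⟨A.zero_mem, B.zero_mem⟩
  smul_mem' := by
    rintro c m ⟨h1, h2⟩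
    exact ⟨by simpa using A.smul_mem c h1, by simpa using B.smul_mem c h2⟩

/-- The pairs of middle vectors that connect `0` to `0` through three relations. -/
def relMidPair (C B A : Submodule ℚ (E × E)) : Submodule ℚ (E × E) :=
  A.comap (LinearMap.inr ℚ E E ∘ₗ LinearMap.fst ℚ E E) ⊓
    (B ⊓ C.comap (LinearMap.inl ℚ E E ∘ₗ LinearMap.snd ℚ E E))

/-- Rank-nullity for the first projection. The second projection computes the same dimension with
the other bracketing, whence the cocycle identity for κ. -/
theorem finrank_relMidPair_left [FiniteDimensional ℚ E] (C B A : Submodule ℚ (E × E)) :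
    Module.finrank ℚ (relMidPair C B A) =
      Module.finrank ℚ (relMid (relComp C B) A) + Module.finrank ℚ (relMid C B) := by
  have h1 : (relMidPair C B A).map (LinearMap.fst ℚ E E) = relMid (relComp C B) A := by
    ext m
    constructor
    · rintro ⟨z, ⟨hA, hB, hC⟩, rfl⟩
      exact ⟨hA, z.2, hB, hC⟩
    · rintro ⟨hA, n, hB, hC⟩
      exact ⟨(m, n), ⟨hA, hB, hC⟩, rfl⟩
  have h2 : relMidPair C B A ⊓ LinearMap.ker (LinearMap.fst ℚ E E) =
      (relMid C B).map (LinearMap.inr ℚ E E) := by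
    ext ⟨m, n⟩
    constructor
    · rintro ⟨⟨hA, hB, hC⟩, hm⟩
      obtain rfl : m = 0 := hm
      exact ⟨n, ⟨hB, hC⟩, rfl⟩
    · rintro ⟨n', ⟨hB, hC⟩, h⟩
      obtain ⟨rfl, rfl⟩ := Prod.mk.inj h
      exact ⟨⟨A.zero_mem, hB, hC⟩, rfl⟩
  rw [← finrank_map_add_finrank_inf_ker (LinearMap.fst ℚ E E), h1, h2,
    finrank_map_of_injective LinearMap.inr_injective]

theorem finrank_relMidPair_right [FiniteDimensional ℚ E] (C B A : Submodule ℚ (E × E)) :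
    Module.finrank ℚ (relMidPair C B A) =
      Module.finrank ℚ (relMid C (relComp B A)) + Module.finrank ℚ (relMid B A) := by
  have h1 : (relMidPair C B A).map (LinearMap.snd ℚ E E) = relMid C (relComp B A) := by
    ext n
    constructor
    · rintro ⟨z, ⟨hA, hB, hC⟩, rfl⟩
      exact ⟨⟨z.1, hA, hB⟩, hC⟩
    · rintro ⟨⟨m, hA, hB⟩, hC⟩
      exact ⟨(m, n), ⟨hA, hB, hC⟩, rfl⟩
  have h2 : relMidPair C B A ⊓ LinearMap.ker (LinearMap.snd ℚ E E) =
      (relMid B A).map (LinearMap.inl ℚ E E) := by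
    ext ⟨m, n⟩
    constructor
    · rintro ⟨⟨hA, hB, hC⟩, hn⟩
      obtain rfl : n = 0 := hn
      exact ⟨m, ⟨hA, hB⟩, rfl⟩
    · rintro ⟨m', ⟨hA, hB⟩, h⟩
      obtain ⟨rfl, rfl⟩ := Prod.mk.inj h
      exact ⟨⟨hA, hB, C.zero_mem⟩, rfl⟩
  rw [← finrank_map_add_finrank_inf_ker (LinearMap.snd ℚ E E), h1, h2,
    finrank_map_of_injective LinearMap.inl_injective]

/-- The pairs `(t - m, m - b)` of increments of the chains `t, m, b` through `A` and `B`. -/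
def incrementPairs (B A : Submodule ℚ (E × E)) : Submodule ℚ (E × E) where
  carrier := {z | ∃ m, (m + z.1, m) ∈ A ∧ (m, m - z.2) ∈ B}
  add_mem' := by
    rintro z w ⟨m, h1, h2⟩ ⟨n, h3, h4⟩
    refine ⟨m + n, ?_, ?_⟩
    · have := A.add_mem h1 h3
      rwa [Prod.mk_add_mk, add_add_add_comm] at this
    · have := B.add_mem h2 h4
      rwa [Prod.mk_add_mk, sub_add_sub_comm] at this
  zero_mem' := ⟨0, (add_zero (0 : E)).symm ▸ A.zero_mem, (sub_zero (0 : E)).symm ▸ B.zero_mem⟩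
  smul_mem' := by
    rintro c z ⟨m, h1, h2⟩
    refine ⟨c • m, ?_, ?_⟩
    · have := A.smul_mem c h1
      rwa [Prod.smul_mk, smul_add] at this
    · have := B.smul_mem c h2
      rwa [Prod.smul_mk, smul_sub] at this

theorem incrementPairs_le_prod (B A : Submodule ℚ (E × E)) :
    incrementPairs B A ≤ (A.map (diff E)).prod (B.map (diff E)) := by
  rintro z ⟨m, h1, h2⟩
  exact ⟨⟨_, h1, by simp⟩, ⟨_, h2, by simp⟩⟩

theorem map_add_incrementPairs (B A : Submodule ℚ (E × E)) :
    (incrementPairs B A).map (LinearMap.fst ℚ E E + LinearMap.snd ℚ E E) =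
      (relComp B A).map (diff E) := by
  ext x
  constructor
  · rintro ⟨z, ⟨m, h1, h2⟩, rfl⟩
    exact ⟨(m + z.1, m - z.2), ⟨m, h1, h2⟩, by simp⟩
  · rintro ⟨z, ⟨m, h1, h2⟩, rfl⟩
    exact ⟨(z.1 - m, m - z.2), ⟨m, by simpa using h1, by simpa using h2⟩, by simp⟩

/-- The chain 0, m, 0 has increments -m and m, of sum zero. -/
theorem map_relMid_le (B A : Submodule ℚ (E × E)) :
    (relMid B A).map (LinearMap.prod (-LinearMap.id) LinearMap.id) ≤
      incrementPairs B A ⊓ LinearMap.ker (LinearMap.fst ℚ E E + LinearMap.snd ℚ E E) := by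
  rintro z ⟨m, ⟨h1, h2⟩, rfl⟩
  exact ⟨⟨m, by simpa using h1, by simpa using h2⟩, by simp⟩

theorem finrank_map_relMid (B A : Submodule ℚ (E × E)) :
    Module.finrank ℚ ((relMid B A).map
      (LinearMap.prod (-LinearMap.id : E →ₗ[ℚ] E) (LinearMap.id : E →ₗ[ℚ] E))) =
      Module.finrank ℚ (relMid B A) :=
  finrank_map_of_injective fun _ _ h => congrArg Prod.snd h

theorem finrank_prod_submodule [FiniteDimensional ℚ E] (S T : Submodule ℚ E) :
    Module.finrank ℚ (S.prod T) = Module.finrank ℚ S + Module.finrank ℚ T := by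
  have h1 : (S.prod T).map (LinearMap.fst ℚ E E) = S := Submodule.prod_map_fst S T
  have h2 : S.prod T ⊓ LinearMap.ker (LinearMap.fst ℚ E E) =
      T.map (LinearMap.inr ℚ E E) := by
    ext ⟨m, n⟩
    constructor
    · rintro ⟨⟨-, hT⟩, hm⟩
      obtain rfl : m = 0 := hm
      exact ⟨n, hT, rfl⟩
    · rintro ⟨n', hT, h⟩
      obtain ⟨rfl, rfl⟩ := Prod.mk.inj h
      exact ⟨⟨S.zero_mem, hT⟩, rfl⟩
  rw [← finrank_map_add_finrank_inf_ker (LinearMap.fst ℚ E E), h1, h2,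
    finrank_map_of_injective LinearMap.inr_injective]

theorem finrank_map_diff_relComp_le [FiniteDimensional ℚ E] (B A : Submodule ℚ (E × E)) :
    Module.finrank ℚ ((relComp B A).map (diff E)) + Module.finrank ℚ (relMid B A) ≤
      Module.finrank ℚ (B.map (diff E)) + Module.finrank ℚ (A.map (diff E)) := by
  have h1 := Submodule.finrank_mono (incrementPairs_le_prod B A)
  have h2 := Submodule.finrank_mono (map_relMid_le B A)
  have h3 := finrank_map_add_finrank_inf_ker (LinearMap.fst ℚ E E + LinearMap.snd ℚ E E)
    (incrementPairs B A)
  rw [map_add_incrementPairs] at h3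
  rw [finrank_prod_submodule] at h1
  rw [finrank_map_relMid] at h2
  omega

/-- When composition is additive for the dimension of the space of differences, the relation `B`
is a modular complement for `relComp B A`. -/
theorem finrank_relComp_inf_of_le [FiniteDimensional ℚ E] {B A : Submodule ℚ (E × E)}
    (h : Module.finrank ℚ (B.map (diff E)) + Module.finrank ℚ (A.map (diff E)) ≤
      Module.finrank ℚ ((relComp B A).map (diff E)) + Module.finrank ℚ (relMid B A)) :
    Module.finrank ℚ ↥(relComp B A ⊓ B) = Module.finrank ℚ (B.map (diff E)) +
      Module.finrank ℚ ↥(relComp B A ⊓ LinearMap.ker (diff E)) := by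
  have h1 := Submodule.finrank_mono (incrementPairs_le_prod B A)
  have h2 := Submodule.finrank_mono (map_relMid_le B A)
  have h3 := finrank_map_add_finrank_inf_ker (LinearMap.fst ℚ E E + LinearMap.snd ℚ E E)
    (incrementPairs B A)
  rw [map_add_incrementPairs] at h3
  rw [finrank_prod_submodule] at h1
  rw [finrank_map_relMid] at h2
  have hfull : incrementPairs B A = (A.map (diff E)).prod (B.map (diff E)) :=
    Submodule.eq_of_le_of_finrank_le (incrementPairs_le_prod B A)
      (by rw [finrank_prod_submodule]; omega)
  have hker := Submodule.eq_of_le_of_finrank_le (map_relMid_le B A)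
      (by rw [finrank_map_relMid]; omega)
  have hmap : (relComp B A ⊓ B).map (diff E) = B.map (diff E) := by
    refine le_antisymm (Submodule.map_mono inf_le_right) ?_
    intro x hx
    -- A chain with increments 0 and x is m, m, m - x, so (m, m - x) lies in both the composite and
    -- `B`.
    have h0 : ((0 : E), x) ∈ incrementPairs B A := by
      rw [hfull]
      exact ⟨Submodule.zero_mem _, hx⟩
    obtain ⟨m, hA, hB⟩ := h0
    exact ⟨(m, m - x), ⟨⟨m, by simpa using hA, hB⟩, hB⟩, by simp⟩
  have hinf : relComp B A ⊓ B ⊓ LinearMap.ker (diff E) =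
      relComp B A ⊓ LinearMap.ker (diff E) := by
    refine le_antisymm (inf_le_inf_right _ inf_le_left) ?_
    rintro ⟨t, b⟩ ⟨hz, hd⟩
    obtain rfl : t = b := mem_ker_diff.1 hd
    refine ⟨⟨hz, ?_⟩, hd⟩
    obtain ⟨m, hA, hB⟩ := hz
    -- The chain t, m, t has increments of sum zero, so they come from a middle vector and (m - t,
    -- 0) ∈ B. Subtracting this from (m, t) ∈ B leaves (t, t).
    have hmem : (t - m, m - t) ∈ incrementPairs B A ⊓
        LinearMap.ker (LinearMap.fst ℚ E E + LinearMap.snd ℚ E E) :=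
      ⟨⟨m, by simpa using hA, by simpa using hB⟩, by simp⟩
    rw [← hker] at hmem
    obtain ⟨n, ⟨-, hn⟩, hn'⟩ := hmem
    obtain rfl : n = m - t := congrArg Prod.snd hn'
    simpa using B.sub_mem hB hn
  rw [← finrank_map_add_finrank_inf_ker (diff E) (relComp B A ⊓ B), hmap, hinf]

end LinearRelation

/-! ### The linear relation of a diagram -/

/-- The linear relation of a partition: the pairs of functions on the top and bottom rows that
together are constant on the blocks. -/
def rel {k : ℕ} (p : Part k) : Submodule ℚ ((Fin k → ℚ) × (Fin k → ℚ)) :=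
  (blockFun p).map (LinearEquiv.sumArrowLequivProdArrow (Fin k) (Fin k) ℚ ℚ : _ →ₗ[ℚ] _)

theorem mem_rel {k : ℕ} {p : Part k} {z : (Fin k → ℚ) × (Fin k → ℚ)} :
    z ∈ rel p ↔ Sum.elim z.1 z.2 ∈ blockFun p := by
  rw [rel, Submodule.mem_map_equiv]
  rfl

theorem finrank_rel {k : ℕ} (p : Part k) : Module.finrank ℚ (rel p) = nc p := by
  rw [rel, LinearEquiv.finrank_map_eq, finrank_blockFun]

theorem rel_injective {k : ℕ} : Function.Injective (rel (k := k)) := fun _ _ h =>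
  blockFun_injective (Submodule.map_injective_of_injective (LinearEquiv.injective _) h)

theorem rel_sup {k : ℕ} (p q : Part k) : rel (p ⊔ q) = rel p ⊓ rel q := by
  ext z
  rw [Submodule.mem_inf, mem_rel, mem_rel, mem_rel, blockFun_sup, Submodule.mem_inf]

theorem rel_idPart (k : ℕ) : rel (idPart k) = LinearMap.ker (diff (Fin k → ℚ)) := by
  ext z
  rw [mem_ker_diff, mem_rel]
  constructor
  · intro h
    funext i
    exact h (Sum.inl i) (Sum.inr i) rfl
  · rintro h (i | i) (j | j) hij <;> obtain rfl : i = j := hij <;> simp [h]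

theorem mem_blockFun_stack {k : ℕ} {p p' : Part k} {f : ThreeRows k → ℚ} :
    f ∈ blockFun (stack p p') ↔ f ∘ topMiddle ∈ blockFun p' ∧ f ∘ middleBottom ∈ blockFun p := by
  constructor
  · intro h
    exact ⟨fun u v huv => h _ _ (.rel _ _ (Or.inl ⟨u, v, huv, rfl, rfl⟩)),
      fun u v huv => h _ _ (.rel _ _ (Or.inr ⟨u, v, huv, rfl, rfl⟩))⟩
  · rintro ⟨h1, h2⟩ x y hxy
    induction hxy with
    | rel x y h =>
      rcases h with ⟨u, v, huv, rfl, rfl⟩ | ⟨u, v, huv, rfl, rfl⟩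
      · exact h1 u v huv
      · exact h2 u v huv
    | refl => rfl
    | symm _ _ _ ih => exact ih.symm
    | trans _ _ _ _ _ ih1 ih2 => exact ih1.trans ih2

theorem elim_mem_blockFun_stack {k : ℕ} {p p' : Part k} {t m b : Fin k → ℚ} :
    Sum.elim t (Sum.elim m b) ∈ blockFun (stack p p') ↔ (t, m) ∈ rel p' ∧ (m, b) ∈ rel p := by
  rw [mem_blockFun_stack, mem_rel, mem_rel]
  have h1 : Sum.elim t (Sum.elim m b) ∘ topMiddle = Sum.elim t m := by
    ext (i | i) <;> rfl
  have h2 : Sum.elim t (Sum.elim m b) ∘ middleBottom = Sum.elim m b := by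
    ext (i | i) <;> rfl
  rw [h1, h2]

theorem exists_elim_three {k : ℕ} (f : ThreeRows k → ℚ) :
    ∃ t m b, f = Sum.elim t (Sum.elim m b) := by
  refine ⟨fun i => f (.inl i), fun i => f (.inr (.inl i)), fun i => f (.inr (.inr i)), ?_⟩
  ext (i | i | i) <;> rfl

theorem elim_comp_topBottom {k : ℕ} (t m b : Fin k → ℚ) :
    Sum.elim t (Sum.elim m b) ∘ topBottom = Sum.elim t b := by
  ext (i | i) <;> rfl

theorem rel_comp {k : ℕ} (p p' : Part k) : rel (comp p p') = relComp (rel p) (rel p') := by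
  ext ⟨t, b⟩
  rw [mem_rel, comp, ← map_funLeft_blockFun, mem_relComp]
  constructor
  · rintro ⟨f, hf, h⟩
    obtain ⟨t', m, b', rfl⟩ := exists_elim_three f
    have h : Sum.elim t' (Sum.elim m b') ∘ topBottom = Sum.elim t b := h
    rw [elim_comp_topBottom] at h
    obtain rfl : t' = t := funext fun i => congrFun h (.inl i)
    obtain rfl : b' = b := funext fun i => congrFun h (.inr i)
    exact ⟨m, elim_mem_blockFun_stack.1 hf⟩
  · rintro ⟨m, h⟩
    exact ⟨_, elim_mem_blockFun_stack.2 h, elim_comp_topBottom t m b⟩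

theorem comp_assoc {k : ℕ} (p q r : Part k) : comp (comp p q) r = comp p (comp q r) :=
  rel_injective (by simp only [rel_comp, relComp_assoc])

theorem comp_idPart {k : ℕ} (p : Part k) : comp p (idPart k) = p := by
  apply rel_injective
  rw [rel_comp, rel_idPart]
  ext z
  constructor
  · rintro ⟨m, hm, h⟩
    obtain rfl : z.1 = m := mem_ker_diff.1 hm
    exact h
  · exact fun h => ⟨z.1, mem_ker_diff.2 rfl, h⟩

theorem range_middle (k : ℕ) : Set.range (middle (k := k)) = (Set.range topBottom)ᶜ := by
  ext (i | i | i) <;> simp [middle, topBottom]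

/-- Both sides count the blocks of the stack lost on restriction to the outer rows; the kernel of
that restriction consists of the functions vanishing on these rows. -/
theorem kappa_eq {k : ℕ} (p p' : Part k) :
    kappa p p' = Module.finrank ℚ (relMid (rel p) (rel p')) := by
  have h1 := nc_eq_nc_comap_add topBottom (stack p p')
  have h2 := finrank_map_add_finrank_inf_ker (LinearMap.funLeft ℚ ℚ topBottom)
    (blockFun (stack p p'))
  rw [map_funLeft_blockFun, finrank_blockFun, finrank_blockFun] at h2
  let e : (Fin k → ℚ) →ₗ[ℚ] (ThreeRows k → ℚ) :=
    { toFun := fun m => Sum.elim 0 (Sum.elim m 0)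
      map_add' := fun m n => by ext (i | i | i) <;> simp
      map_smul' := fun c m => by ext (i | i | i) <;> simp }
  have he : Function.Injective e := fun m n h => by
    funext i
    exact congrFun h (.inr (.inl i))
  have h3 : (relMid (rel p) (rel p')).map e = blockFun (stack p p') ⊓
      LinearMap.ker (LinearMap.funLeft ℚ ℚ topBottom) := by
    ext f
    constructor
    · rintro ⟨m, hm, rfl⟩
      refine ⟨elim_mem_blockFun_stack.2 hm, ?_⟩
      rw [SetLike.mem_coe, LinearMap.mem_ker]
      ext (i | i) <;> rfl
    · rintro ⟨hf, h⟩
      obtain ⟨t, m, b, rfl⟩ := exists_elim_three f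
      have h : Sum.elim t (Sum.elim m b) ∘ topBottom = 0 := h
      obtain rfl : t = 0 := funext fun i => congrFun h (.inl i)
      obtain rfl : b = 0 := funext fun i => congrFun h (.inr i)
      exact ⟨m, elim_mem_blockFun_stack.1 hf, rfl⟩
  rw [← h3, finrank_map_of_injective he] at h2
  rw [kappa, range_middle]
  omega

/-! ### The defect -/

/-- The number of gluings needed to make `i` and `i'` belong to the same block for all `i`. -/
noncomputable def defect {k : ℕ} (p : Part k) : ℕ := Module.finrank ℚ ((rel p).map (diff (Fin k → ℚ)))

theorem defect_add_nc {k : ℕ} (p : Part k) : defect p + nc (p ⊔ idPart k) = nc p := by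
  rw [defect, ← finrank_rel, ← finrank_rel, rel_sup, rel_idPart,
    finrank_map_add_finrank_inf_ker]

theorem defect_comp_add_kappa_le {k : ℕ} (p q : Part k) :
    defect (comp p q) + kappa p q ≤ defect p + defect q := by
  rw [defect, rel_comp, kappa_eq]
  exact finrank_map_diff_relComp_le _ _

theorem kappa_cocycle {k : ℕ} (p q r : Part k) :
    kappa (comp p q) r + kappa p q = kappa p (comp q r) + kappa q r := by
  rw [kappa_eq, kappa_eq, kappa_eq, kappa_eq, rel_comp, rel_comp, ← finrank_relMidPair_left, ← finrank_relMidPair_right]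

theorem nc_idPart (k : ℕ) : nc (idPart k) = k := by
  have h : Set.InjOn (fun i : Fin k => {x | idPart k x (Sum.inl i)}) Set.univ := by
    intro i _ j _ h
    exact h.subset (show idPart k (Sum.inl i) (Sum.inl i) from rfl)
  have himg : (idPart k).classes =
      (fun i : Fin k => {x | idPart k x (Sum.inl i)}) '' Set.univ := by
    ext c
    constructor
    · rintro ⟨i | i, rfl⟩ <;> exact ⟨i, trivial, rfl⟩
    · rintro ⟨i, -, rfl⟩
      exact ⟨Sum.inl i, rfl⟩
  rw [nc, himg, h.ncard_image, Set.ncard_univ, Nat.card_fin]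

/-- The distance from `idPart k` to p is defect p + (k - nc p) / 2, and the halves cancel against
the correction term. -/
theorem prec_iff {k : ℕ} {p' p : Part k} : Prec p' p ↔
    ∃ p'', p = comp p' p'' ∧ defect p + kappa p' p'' = defect p' + defect p'' := by
  refine exists_congr fun p'' => and_congr_right fun _ => ?_
  have h1 : (defect p : ℚ) + nc (p ⊔ idPart k) = nc p := by exact_mod_cast defect_add_nc p
  have h2 : (defect p' : ℚ) + nc (p' ⊔ idPart k) = nc p' := by exact_mod_cast defect_add_nc p'
  have h3 : (defect p'' : ℚ) + nc (p'' ⊔ idPart k) = nc p'' := by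
    exact_mod_cast defect_add_nc p''
  rw [geodDist_eq, geodDist_eq, geodDist_eq, nc_idPart, ← @Nat.cast_inj ℚ]
  push_cast
  constructor <;> intro h <;> linarith

theorem prec_refl {k : ℕ} (p : Part k) : Prec p p := by
  refine prec_iff.2 ⟨idPart k, (comp_idPart p).symm, ?_⟩
  have h1 := defect_comp_add_kappa_le p (idPart k)
  have h2 := defect_add_nc (idPart k)
  rw [comp_idPart] at h1
  rw [sup_idem] at h2
  omega

theorem prec_trans {k : ℕ} {p q r : Part k} (hpq : Prec p q) (hqr : Prec q r) : Prec p r := by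
  obtain ⟨a, rfl, ha⟩ := prec_iff.1 hpq
  obtain ⟨c, rfl, hc⟩ := prec_iff.1 hqr
  refine prec_iff.2 ⟨comp a c, comp_assoc p a c, ?_⟩
  -- By the cocycle identity, the two hypotheses add up to the sum of the inequalities `h1` and `h2`
  -- with equality; hence each is an equality.
  have h1 := defect_comp_add_kappa_le p (comp a c)
  have h2 := defect_comp_add_kappa_le a c
  have h3 := kappa_cocycle p a c
  rw [comp_assoc] at hc ⊢
  omega

/-! ### Comparison with the geodesic order -/

theorem geodLE_of_prec {k : ℕ} {p' p : Part k} (h : Prec p' p) : GeodLE p' p := by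
  obtain ⟨a, rfl, ha⟩ := prec_iff.1 h
  rw [defect, rel_comp, kappa_eq, defect, defect] at ha
  have h1 := finrank_relComp_inf_of_le ha.ge
  rw [← rel_comp, ← rel_idPart, ← rel_sup, ← rel_sup, finrank_rel, finrank_rel] at h1
  have h2 := defect_add_nc p'
  rw [defect] at h2
  have h3 : nc (comp p' a ⊔ p') + nc (p' ⊔ idPart k) = nc p' + nc (comp p' a ⊔ idPart k) := by
    omega
  have h4 : (nc (comp p' a ⊔ p') : ℚ) + nc (p' ⊔ idPart k) =
      nc p' + nc (comp p' a ⊔ idPart k) := by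
    exact_mod_cast h3
  change geodDist _ _ + geodDist _ _ = geodDist _ _
  simp only [geodDist_eq]
  linarith

/-- Adding the two equalities gives d(p, q) = 0, so both partitions equal their join. -/
theorem eq_of_geodLE_of_geodLE {k : ℕ} {p q : Part k} (h : GeodLE p q) (h' : GeodLE q p) :
    p = q := by
  have h : geodDist (idPart k) p + geodDist p q = geodDist (idPart k) q := h
  have h' : geodDist (idPart k) q + geodDist q p = geodDist (idPart k) p := h'
  simp only [geodDist_eq] at h h'
  have h1 : nc p + nc q = nc (q ⊔ p) + nc (q ⊔ p) := by
    rw [sup_comm p q] at h'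
    have : (nc p : ℚ) + nc q = nc (q ⊔ p) + nc (q ⊔ p) := by linarith
    exact_mod_cast this
  have h2 := nc_le_nc (le_sup_left : q ≤ q ⊔ p)
  have h3 := nc_le_nc (le_sup_right : p ≤ q ⊔ p)
  have h4 := eq_of_le_of_nc_le (le_sup_left : q ≤ q ⊔ p) (by omega)
  have h5 := eq_of_le_of_nc_le (le_sup_right : p ≤ q ⊔ p) (by omega)
  exact h5.trans h4.symm

/-- The partition whose blocks are the top row and the singletons of the bottom row. -/
def topBlock (k : ℕ) : Part k :=
  Setoid.ker (Sum.elim (fun _ => none) some : Fin k ⊕ Fin k → Option (Fin k))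

theorem topBlock_sup_idPart (k : ℕ) : topBlock k ⊔ idPart k = ⊤ := by
  refine eq_top_iff.2 fun x y _ => ?_
  set s := topBlock k ⊔ idPart k
  have h1 : topBlock k ≤ s := le_sup_left
  have h2 : idPart k ≤ s := le_sup_right
  have h3 : ∀ x, ∃ i, s x (Sum.inl i) := by
    rintro (i | i)
    · exact ⟨i, s.refl _⟩
    · exact ⟨i, h2 (show idPart k (Sum.inr i) (Sum.inl i) from rfl)⟩
  obtain ⟨i, hi⟩ := h3 x
  obtain ⟨j, hj⟩ := h3 y
  exact s.trans hi (s.trans (h1 (show topBlock k (Sum.inl i) (Sum.inl j) from rfl)) (s.symm hj))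

theorem geodLE_top_topBlock (k : ℕ) : GeodLE (⊤ : Part k) (topBlock k) := by
  change geodDist _ _ + geodDist _ _ = geodDist _ _
  rw [geodDist_eq, geodDist_eq, geodDist_eq, topBlock_sup_idPart, top_sup_eq, sup_top_eq]
  ring

/-- Whatever is stacked above ⊤, the bottom row of the product lies in one block, whereas two bottom
vertices of `topBlock k` are never joined. -/
theorem not_prec_top_topBlock {k : ℕ} (hk : 2 ≤ k) : ¬ Prec (⊤ : Part k) (topBlock k) := by
  rintro ⟨a, h, -⟩
  let i : Fin k := ⟨0, by omega⟩
  let j : Fin k := ⟨1, by omega⟩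
  have hij : comp ⊤ a (Sum.inr i) (Sum.inr j) :=
    .rel _ _ (Or.inr ⟨Sum.inr i, Sum.inr j, trivial, rfl, rfl⟩)
  rw [← h] at hij
  have : some i = some j := hij
  simp [i, j] at this

end PartitionOrders

theorem mainTheorem7 (k : ℕ) :
    -- `≺` is a partial order on `𝒫_k`
    (∀ p : PartitionOrders.Part k, PartitionOrders.Prec p p) ∧
    (∀ p q : PartitionOrders.Part k,
      PartitionOrders.Prec p q → PartitionOrders.Prec q p → p = q) ∧
    (∀ p q r : PartitionOrders.Part k,
      PartitionOrders.Prec p q → PartitionOrders.Prec q r → PartitionOrders.Prec p r) ∧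
    -- `≺` implies the geodesic order
    (∀ p' p : PartitionOrders.Part k, PartitionOrders.Prec p' p → PartitionOrders.GeodLE p' p) ∧
    -- `≺` differs from the geodesic order
    (2 ≤ k → ∃ p' p : PartitionOrders.Part k,
      PartitionOrders.GeodLE p' p ∧ ¬ PartitionOrders.Prec p' p) := by
  open PartitionOrders in
  exact ⟨prec_refl, fun _ _ h h' =>
      eq_of_geodLE_of_geodLE (geodLE_of_prec h) (geodLE_of_prec h'),
    fun _ _ _ => prec_trans, fun _ _ => geodLE_of_prec,
    fun hk => ⟨⊤, topBlock k, geodLE_top_topBlock k, not_prec_top_topBlock hk⟩⟩
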